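/- Let $G=(V,w,m)$ be a locally finite weighted graph: $w:V\times V\to[0,\infty)$ is symmetric, $m:V\to(0,\infty)$, and for every $x$ there are only finitely many $y$ with $w(x,y)>0$ (locally finite simple graphs are the case $w\in\{0,1\}$, $m\equiv 1$). Distinct vertices $x,y$ are adjacent when $w(x,y)>0$; $d$ is the combinatorial distance ($d(x,y)=\infty$ for vertices in different components). Put $$\Delta f(x)=\frac1{m(x)}\sum_y w(x,y)\,(f(y)-f(x)),\qquad |\nabla_R f|(x)=\max_{d(x,y)\le R}|f(y)-f(x)|,$$ and let $(P_t)_{t\ge0}$ be the heat semigroup generated by $\Delta$ on bounded functions, $P_tf(x)=\sum_y p_t(x,y)f(y)$, where $p_t(x,y)=\sup_U e^{t\Delta_U}(x,y)$ is the minimal heat kernel; here $U$ runs over the finite subsets of $V$ containing $x$ and $y$, and $\Delta_U$ is the restriction of $\Delta$ to $U$ with Dirichlet boundary condition. For an integer $R>0$ and $x,y\in V$ with $d(x,y)\le R$ the quadratic Gradient-Ollivier curvature is $$K^q_R(x,y)=\frac12\inf_{g}\left[\Delta|\nabla_R g|^2(x)-\operatorname{sgn}(g(y)-g(x))\left(\frac{\Delta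 g^2}{g}(y)-\frac{\Delta g^2}{g}(x)\right)\right]\in[-\infty,\infty],$$ where the infimum is over all $g:V\to(0,\infty)$ with $|\nabla_R g|(x)=1$ and $|g(y)-g(x)|=1$, and $\inf\emptyset=+\infty$. Theorem. Let $R>0$ be an integer and $K\in\mathbb R$. The following are equivalent: (i) $K^q_R(x,y)\ge K$ for all $x,y\in V$ with $d(x,y)\le R$. (ii) For every bounded $f:V\to(0,\infty)$ and every $t\ge0$, pointwise on $V$, $$\left|\nabla_R\sqrt{P_tf}\right|^2\le e^{-2Kt}\,P_t\left|\nabla_R\sqrt f\right|^2 .$$ -/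

import Mathlib

/-- A weighted graph `G = (V, w, m)`: symmetric edge weights `w ≥ 0` and a positive vertex measure
`m`, such that every vertex has only finitely many neighbours. Simple graphs (locally finite) are the
case `w ∈ {0, 1}`, `m = 1`. -/
structure WeightedGraph (V : Type*) where
  w : V → V → ℝ
  m : V → ℝ
  w_nonneg : ∀ x y, 0 ≤ w x y
  w_symm : ∀ x y, w x y = w y x
  m_pos : ∀ x, 0 < m x
  locallyFinite : ∀ x, {y | 0 < w x y}.Finite

namespace WeightedGraph

variable {V : Type*} (G : WeightedGraph V)

/-- The underlying simple graph; a loop `w x x > 0` affects neither distances nor the Laplacian. -/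
def toSimpleGraph : SimpleGraph V where
  Adj x y := x ≠ y ∧ 0 < G.w x y
  symm := ⟨fun x y h => ⟨h.1.symm, by rw [G.w_symm]; exact h.2⟩⟩
  loopless := ⟨fun _ h => h.1 rfl⟩

/-- The combinatorial distance, `⊤` for vertices in different components. -/
noncomputable def d (x y : V) : ℕ∞ := G.toSimpleGraph.edist x y

/-- The finite set of all `y` with `w x y > 0`. -/
noncomputable def nbrs (x : V) : Finset V := (G.locallyFinite x).toFinset

/-- `Δ f (x) = (1 / m x) ∑_y w x y (f y - f x)`; terms with `w x y = 0` vanish. -/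
noncomputable def laplacian (f : V → ℝ) (x : V) : ℝ :=
  1 / G.m x * ∑ y ∈ G.nbrs x, G.w x y * (f y - f x)

/-- The ball `B_R(x) = {y | d x y ≤ R}`. -/
def ball (R : ℕ) (x : V) : Set V := {y | G.d x y ≤ R}

theorem mem_ball_self (R : ℕ) (x : V) : x ∈ G.ball R x := by
  simp [ball, d]

theorem ball_finite (R : ℕ) (x : V) : (G.ball R x).Finite := by
  induction R generalizing x with
  | zero =>
    refine (Set.finite_singleton x).subset ?_
    intro y hy
    have h : y = x := by simpa [ball, d] using hy
    simp [h]
  | succ n ih =>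
    refine ((Set.finite_singleton x).union
      ((G.locallyFinite x).biUnion fun z _ => ih z)).subset ?_
    intro y hy
    have hy' : G.toSimpleGraph.edist x y ≤ ((n + 1 : ℕ) : ℕ∞) := hy
    have hne : G.toSimpleGraph.edist x y ≠ ⊤ :=
      ne_top_of_le_ne_top (ENat.natCast_ne_top _) hy'
    obtain ⟨p, hp⟩ := SimpleGraph.exists_walk_of_edist_ne_top hne
    rw [← hp] at hy'
    have hlen : p.length ≤ n + 1 := by exact_mod_cast hy'
    cases p with
    | nil => exact Or.inl rfl
    | cons hadj q =>
      rename_i z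
      refine Or.inr (Set.mem_biUnion (show z ∈ {y | 0 < G.w x y} from hadj.2) ?_)
      have hq : q.length ≤ n := by simpa using hlen
      have hq' : G.toSimpleGraph.edist z y ≤ (q.length : ℕ∞) := SimpleGraph.edist_le q
      exact hq'.trans (by exact_mod_cast hq)

/-- The `R`-gradient `|∇_R f|(x) = max_{d x y ≤ R} |f y - f x|`. -/
noncomputable def rGradient (R : ℕ) (f : V → ℝ) (x : V) : ℝ :=
  ⨆ y : G.ball R x, |f y - f x|

/-- The supremum defining the `R`-gradient is a maximum. -/
theorem rGradient_isGreatest (R : ℕ) (f : V → ℝ) (x : V) :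
    IsGreatest ((fun y => |f y - f x|) '' G.ball R x) (G.rGradient R f x) := by
  have hfin : ((fun y => |f y - f x|) '' G.ball R x).Finite := (G.ball_finite R x).image _
  have hne : ((fun y => |f y - f x|) '' G.ball R x).Nonempty :=
    ⟨_, x, G.mem_ball_self R x, rfl⟩
  have h : G.rGradient R f x = sSup ((fun y => |f y - f x|) '' G.ball R x) := by
    rw [rGradient, sSup_image']
  rw [h]
  exact ⟨hne.csSup_mem hfin, fun a ha => le_csSup hfin.bddAbove ha⟩

/-- The Dirichlet Laplacian of a finite vertex set `U`, as a matrix: extend a function on `U` by `0`,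
apply the Laplacian, restrict to `U`. -/
noncomputable def dirichletLaplacian (U : Finset V) : Matrix U U ℝ :=
  Matrix.of fun x y => G.laplacian (Set.indicator {(y : V)} 1) x

open Classical in
/-- The Dirichlet heat kernel `exp (t Δ_U) (x, y)` of a finite vertex set `U` (zero off `U × U`), with
respect to the counting measure. -/
noncomputable def dirichletHeatKernel (U : Finset V) (t : ℝ) (x y : V) : ℝ :=
  if h : x ∈ U ∧ y ∈ U then
    NormedSpace.exp (t • G.dirichletLaplacian U) ⟨x, h.1⟩ ⟨y, h.2⟩
  else 0

/-- The (minimal) heat kernel of the graph: the supremum, which is the monotone limit, of the Dirichlet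
heat kernels over the finite vertex sets. All of them take values in `[0, 1]` for `t ≥ 0`. -/
noncomputable def heatKernel (t : ℝ) (x y : V) : ℝ :=
  ⨆ U : Finset V, G.dirichletHeatKernel U t x y

/-- The heat semigroup `P_t` generated by `Δ`, on bounded functions. -/
noncomputable def heat (t : ℝ) (f : V → ℝ) (x : V) : ℝ :=
  ∑' y, G.heatKernel t x y * f y

/-- The quadratic Gradient-Ollivier curvature `K^q_R(x,y)`, with values in `[-∞, ∞]`
(the infimum over the empty set is `+∞`). -/
noncomputable def quadraticCurvature (R : ℕ) (x y : V) : EReal :=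
  ((1 / 2 : ℝ) : EReal) *
    ⨅ g ∈ {g : V → ℝ | (∀ z, 0 < g z) ∧ G.rGradient R g x = 1 ∧ |g y - g x| = 1},
      ((G.laplacian (fun z => G.rGradient R g z ^ 2) x
        - Real.sign (g y - g x) *
          (G.laplacian (fun z => g z ^ 2) y / g y - G.laplacian (fun z => g z ^ 2) x / g x) : ℝ) :
        EReal)

end WeightedGraph

/-!
A positive function `u = √(P_t f)` satisfies `∂_t u² = Δ u²`, so the difference `u y - u x` of its values
moves with velocity `(Δu²(y) / u(y) - Δu²(x) / u(x)) / 2`. If `y` realizes `|∇_R u|` at `x`, the curvature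
bound `K^q_R(x,y) ≥ K`, scaled to `u`, says exactly that `(u y - u x)²` moves with velocity at most
`Δ|∇_R u|²(x) - 2K |∇_R u|²(x)` (`two_mul_mul_sq_le_of_le_quadraticCurvature`,
`hasDerivWithinAt_sq_sqrt_heat_sub`). Thus `e^{2Kt} |∇_R u|²` is a bounded subsolution of the heat equation
with initial value `|∇_R √f|²`, and the gradient estimate says that it lies below the minimal solution
`P_t |∇_R √f|²`.

On an infinite graph this comparison requires control at infinity, which again comes from the curvature.
Testing `K^q_R` with `h + c`, `c → ∞`, where `h` is Lipschitz for the metric `r = ⌈d / R⌉`, recovers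
a lower bound of Ollivier type, `Δh(y) ≤ Δh(x) - K` if `h y = h x + 1`
(`laplacian_le_sub_of_le_quadraticCurvature`). Along a geodesic from `o` this sums to `Δr ≤ Δr(o) - K r` for
`r = r(o, ·)` (`laplacian_radial_le`). As balls are finite, `r` is an exhaustion, and `ε e^{λt} (1 + r)` with
`λ` large is a strict supersolution that dominates bounded functions outside a finite set. Adding it as an
error confines the comparison to finitely many pairs `(x, y)`, where an elementary first-touch argument
(`neg_of_hasDerivWithinAt_neg_of_first_zero`) proves it (`exp_mul_rGradient_sq_sub_heat_lt`); then `ε → 0`.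

Conversely, both sides of the gradient estimate agree at `t = 0` if `√f` is a test function of the
curvature, and comparing right derivatives there gives the curvature bound
(`le_quadraticCurvature_of_gradient_estimate`).

All that is needed of the heat semigroup is that `t ↦ P_t f` solves the heat equation pointwise on `[0, ∞)`
for bounded nonnegative `f` (`hasDerivWithinAt_heat`). This passes to the limit from the finite Dirichlet
problems, which increase to `P_t f` by the minimum principle.
-/

open Set Filter Topology

/-! ### A first-touch principle -/

/-- If finitely many functions start out negative, and whichever of them vanishes while all others are
nonpositive has negative derivative there, then all of them stay negative: at the first zero of one of
them its derivative from the left would be nonnegative. -/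
theorem neg_of_hasDerivWithinAt_neg_of_first_zero {ι : Type*} {s : Set ι} (hs : s.Finite)
    (D : ι → ℝ → ℝ) (hcont : ∀ i ∈ s, ContinuousOn (D i) (Ici 0)) (h0 : ∀ i ∈ s, D i 0 < 0)
    (hstep : ∀ i ∈ s, ∀ t > 0, D i t = 0 → (∀ j ∈ s, D j t ≤ 0) →
      ∃ D', HasDerivWithinAt (D i) D' (Ici 0) t ∧ D' < 0) :
    ∀ i ∈ s, ∀ t, 0 ≤ t → D i t < 0 := by
  intro i₀ hi₀ t₀ ht₀
  by_contra! hpos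
  set A : Set ℝ := ⋃ i ∈ s, (Icc 0 t₀ ∩ D i ⁻¹' Ici 0) with hA
  have hAc : IsCompact A := hs.isCompact_biUnion fun i hi =>
    isCompact_Icc.of_isClosed_subset
      (((hcont i hi).mono Icc_subset_Ici_self).preimage_isClosed_of_isClosed isClosed_Icc isClosed_Ici)
      inter_subset_left
  have hAne : A.Nonempty := ⟨t₀, by
    simp only [hA, mem_iUnion]
    exact ⟨i₀, hi₀, ⟨ht₀, le_rfl⟩, hpos⟩⟩
  obtain ⟨t, htA, htmin⟩ := hAc.exists_isLeast hAne
  simp only [hA, mem_iUnion] at htA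
  obtain ⟨i, hi, ⟨ht0, htt₀⟩, hit⟩ := htA
  have hit : 0 ≤ D i t := hit
  have htpos : 0 < t := by
    rcases ht0.eq_or_lt with h | h
    · subst h
      exact absurd (h0 i hi) (not_lt.2 hit)
    · exact h
  have hbefore : ∀ j ∈ s, ∀ r, 0 ≤ r → r < t → D j r < 0 := by
    intro j hj r hr hrt
    by_contra! h
    exact absurd (htmin (show r ∈ A by
      simp only [hA, mem_iUnion]
      exact ⟨j, hj, ⟨hr, hrt.le.trans htt₀⟩, h⟩)) (not_le.2 hrt)
  have hev : ∀ᶠ r in 𝓝[<] t, 0 ≤ r ∧ r < t := by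
    filter_upwards [Ioo_mem_nhdsLT htpos] with r hr using ⟨hr.1.le, hr.2⟩
  have hle : ∀ j ∈ s, D j t ≤ 0 := by
    intro j hj
    have hc : Tendsto (D j) (𝓝[<] t) (𝓝 (D j t)) :=
      ((hcont j hj).continuousAt (Ici_mem_nhds htpos)).tendsto.mono_left nhdsWithin_le_nhds
    exact le_of_tendsto hc (hev.mono fun r hr => (hbefore j hj r hr.1 hr.2).le)
  have hzero : D i t = 0 := le_antisymm (hle i hi) hit
  obtain ⟨D', hD', hneg⟩ := hstep i hi t htpos hzero hle
  have hslope : Tendsto (slope (D i) t) (𝓝[<] t) (𝓝 D') :=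
    (hasDerivAt_iff_tendsto_slope.1 (hD'.hasDerivAt (Ici_mem_nhds htpos))).mono_left
      (nhdsWithin_mono t fun r hr => (ne_of_lt hr : r ≠ t))
  refine absurd (ge_of_tendsto hslope (hev.mono fun r hr => ?_)) (not_le.2 hneg)
  rw [slope_def_field, hzero, sub_zero]
  exact (div_pos_of_neg_of_neg (hbefore i hi r hr.1 hr.2) (sub_neg.2 hr.2)).le

/-! ### One-sided calculus on `[0, ∞)` -/

/-- A first-order Taylor estimate on `[0, ∞)` from a bound on the second derivative. -/
theorem abs_sub_sub_mul_le_of_abs_second_deriv_le {φ φ' φ'' : ℝ → ℝ} {L : ℝ}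
    (hφ : ∀ t ∈ Ici (0 : ℝ), HasDerivWithinAt φ (φ' t) (Ici 0) t)
    (hφ' : ∀ t ∈ Ici (0 : ℝ), HasDerivWithinAt φ' (φ'' t) (Ici 0) t)
    (hL : ∀ t ∈ Ici (0 : ℝ), |φ'' t| ≤ L) {s t : ℝ} (hs : 0 ≤ s) (ht : 0 ≤ t) :
    |φ s - φ t - (s - t) * φ' t| ≤ L * (s - t) ^ 2 := by
  have hL0 : 0 ≤ L := (abs_nonneg _).trans (hL 0 self_mem_Ici)
  have hsub : uIcc t s ⊆ Ici (0 : ℝ) := fun r hr => (le_min ht hs).trans hr.1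
  have h1 : ∀ r ∈ uIcc t s, ‖φ' r - φ' t‖ ≤ L * |s - t| := fun r hr =>
    ((convex_Ici 0).norm_image_sub_le_of_norm_hasDerivWithin_le hφ' hL ht (hsub hr)).trans
      (mul_le_mul_of_nonneg_left (abs_sub_left_of_mem_uIcc hr) hL0)
  have h2 := (convex_uIcc t s).norm_image_sub_le_of_norm_hasDerivWithin_le
    (f := fun r => φ r - (r - t) * φ' t) (f' := fun r => φ' r - φ' t)
    (fun r hr => by
      simpa using ((hφ r (hsub hr)).mono hsub).fun_sub
        (((hasDerivWithinAt_id r (uIcc t s)).sub_const t).mul_const (φ' t)))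
    h1 left_mem_uIcc right_mem_uIcc
  rw [Real.norm_eq_abs, Real.norm_eq_abs] at h2
  calc |φ s - φ t - (s - t) * φ' t| = |φ s - (s - t) * φ' t - (φ t - (t - t) * φ' t)| := by
        congr 1; ring
    _ ≤ L * |s - t| * |s - t| := h2
    _ = L * (s - t) ^ 2 := by rw [mul_assoc, abs_mul_abs_self, sq]

theorem hasDerivWithinAt_of_abs_sub_sub_mul_le {φ : ℝ → ℝ} {d L t : ℝ} {S : Set ℝ}
    (h : ∀ s ∈ S, |φ s - φ t - (s - t) * d| ≤ L * (s - t) ^ 2) : HasDerivWithinAt φ d S t := by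
  rw [hasDerivWithinAt_iff_isLittleO]
  refine (Asymptotics.IsBigO.of_bound L ?_).trans_isLittleO
    ((Asymptotics.isLittleO_pow_sub_sub t one_lt_two).mono nhdsWithin_le_nhds)
  filter_upwards [self_mem_nhdsWithin] with s hs
  simpa using h s hs

/-- If `a ≤ b` on `[0, ∞)` with equality at `0`, the right derivatives at `0` are ordered. -/
theorem hasDerivWithinAt_le_of_le_of_eq {a b : ℝ → ℝ} {a' b' : ℝ}
    (ha : HasDerivWithinAt a a' (Ici 0) 0) (hb : HasDerivWithinAt b b' (Ici 0) 0)
    (h0 : a 0 = b 0) (hle : ∀ t, 0 ≤ t → a t ≤ b t) : a' ≤ b' := by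
  have h := (hasDerivWithinAt_iff_tendsto_slope' self_notMem_Ioi).1
    (hasDerivWithinAt_Ioi_iff_Ici.2 (hb.fun_sub ha))
  rw [← sub_nonneg]
  refine ge_of_tendsto h ?_
  filter_upwards [self_mem_nhdsWithin] with t ht
  have ht : 0 < t := ht
  rw [slope_def_field, h0, sub_self, sub_zero, sub_zero]
  exact div_nonneg (sub_nonneg.2 (hle t ht.le)) ht.le

namespace WeightedGraph

variable {V : Type*} (G : WeightedGraph V)

/-! ### The Laplacian -/

theorem mem_nbrs {x y : V} : y ∈ G.nbrs x ↔ 0 < G.w x y := by simp [nbrs]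

theorem laplacian_mono {a b : V → ℝ} {x : V}
    (h : ∀ z ∈ G.nbrs x, a z - a x ≤ b z - b x) : G.laplacian a x ≤ G.laplacian b x := by
  unfold laplacian
  have := G.m_pos x
  exact mul_le_mul_of_nonneg_left (Finset.sum_le_sum fun z hz =>
    mul_le_mul_of_nonneg_left (h z hz) (G.w_nonneg x z)) (by positivity)

theorem laplacian_congr {a b : V → ℝ} {x : V} (hx : a x = b x)
    (h : ∀ z ∈ G.nbrs x, a z = b z) : G.laplacian a x = G.laplacian b x := by
  unfold laplacian
  congr 1
  exact Finset.sum_congr rfl fun z hz => by rw [h z hz, hx]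

theorem laplacian_const (c : ℝ) (x : V) : G.laplacian (fun _ => c) x = 0 := by simp [laplacian]

theorem laplacian_add (a b : V → ℝ) (x : V) :
    G.laplacian (fun z => a z + b z) x = G.laplacian a x + G.laplacian b x := by
  simp only [laplacian, ← mul_add, ← Finset.sum_add_distrib]
  congr 1
  exact Finset.sum_congr rfl fun z _ => by ring

theorem laplacian_const_mul (c : ℝ) (a : V → ℝ) (x : V) :
    G.laplacian (fun z => c * a z) x = c * G.laplacian a x := by
  simp only [laplacian, ← mul_sub, mul_left_comm _ c, ← Finset.mul_sum]

theorem laplacian_sub (a b : V → ℝ) (x : V) :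
    G.laplacian (fun z => a z - b z) x = G.laplacian a x - G.laplacian b x := by
  have h := G.laplacian_add a (fun z => -1 * b z) x
  rw [G.laplacian_const_mul] at h
  simpa [sub_eq_add_neg] using h

theorem laplacian_sum {ι : Type*} (s : Finset ι) (a : ι → V → ℝ) (x : V) :
    G.laplacian (fun z => ∑ i ∈ s, a i z) x = ∑ i ∈ s, G.laplacian (a i) x := by
  classical
  induction s using Finset.induction_on with
  | empty => simp [laplacian]
  | insert i s hi ih => simp only [Finset.sum_insert hi, laplacian_add, ih]

/-- The weighted vertex degree `(1 / m x) ∑_y w x y`. -/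
noncomputable def deg (x : V) : ℝ := 1 / G.m x * ∑ y ∈ G.nbrs x, G.w x y

theorem deg_nonneg (x : V) : 0 ≤ G.deg x :=
  mul_nonneg (one_div_nonneg.2 (G.m_pos x).le) (Finset.sum_nonneg fun y _ => G.w_nonneg x y)

theorem abs_laplacian_le {a : V → ℝ} {x : V} {B : ℝ} (hx : |a x| ≤ B)
    (h : ∀ z ∈ G.nbrs x, |a z| ≤ B) : |G.laplacian a x| ≤ 2 * G.deg x * B := by
  have hm := G.m_pos x
  rw [laplacian, abs_mul, abs_of_pos (by positivity : 0 < 1 / G.m x)]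
  calc 1 / G.m x * |∑ y ∈ G.nbrs x, G.w x y * (a y - a x)|
      ≤ 1 / G.m x * ∑ y ∈ G.nbrs x, G.w x y * (B + B) := by
        gcongr
        refine (Finset.abs_sum_le_sum_abs _ _).trans (Finset.sum_le_sum fun z hz => ?_)
        rw [abs_mul, abs_of_nonneg (G.w_nonneg _ _)]
        have := G.w_nonneg x z
        gcongr
        exact (abs_sub _ _).trans (add_le_add (h z hz) hx)
    _ = 2 * G.deg x * B := by rw [deg, ← Finset.sum_mul]; ring

theorem neg_deg_mul_le_laplacian {a : V → ℝ} (ha : ∀ z, 0 ≤ a z) (x : V) :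
    -G.deg x * a x ≤ G.laplacian a x := by
  have hm := G.m_pos x
  calc -G.deg x * a x = 1 / G.m x * ∑ y ∈ G.nbrs x, G.w x y * (0 - a x) := by
        rw [deg, ← Finset.sum_mul]; ring
    _ ≤ G.laplacian a x := by
        unfold laplacian
        gcongr with z hz
        · exact G.w_nonneg _ _
        · exact ha z

theorem hasDerivWithinAt_laplacian {v v' : ℝ → V → ℝ} {s : Set ℝ} {t : ℝ} {x : V}
    (hx : HasDerivWithinAt (fun r => v r x) (v' t x) s t)
    (h : ∀ z ∈ G.nbrs x, HasDerivWithinAt (fun r => v r z) (v' t z) s t) :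
    HasDerivWithinAt (fun r => G.laplacian (v r) x) (G.laplacian (v' t) x) s t := by
  unfold laplacian
  exact (HasDerivWithinAt.fun_sum fun z hz => ((h z hz).sub hx).const_mul _).const_mul _

theorem tendsto_laplacian {ι : Type*} {l : Filter ι} {a : ι → V → ℝ} {b : V → ℝ} {x : V}
    (hx : Tendsto (fun i => a i x) l (𝓝 (b x)))
    (h : ∀ z ∈ G.nbrs x, Tendsto (fun i => a i z) l (𝓝 (b z))) :
    Tendsto (fun i => G.laplacian (a i) x) l (𝓝 (G.laplacian b x)) := by
  unfold laplacian
  exact (tendsto_finsetSum _ fun z hz => ((h z hz).sub hx).const_mul _).const_mul _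

/-! ### The Dirichlet heat flow on a finite vertex set -/

/-- The parabolic minimum principle on a finite vertex set. -/
theorem nonneg_of_heat_equation_on_finset (U : Finset V) (v : ℝ → V → ℝ)
    (hv : ∀ x ∈ U, ∀ t, 0 ≤ t →
      HasDerivWithinAt (fun s => v s x) (G.laplacian (v t) x) (Ici 0) t)
    (hoff : ∀ x ∉ U, ∀ t, 0 ≤ t → 0 ≤ v t x) (h0 : ∀ x ∈ U, 0 ≤ v 0 x) :
    ∀ t, 0 ≤ t → ∀ x, 0 ≤ v t x := by
  intro t ht x
  by_cases hx : x ∈ U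
  swap
  · exact hoff x hx t ht
  have key : ∀ ε > 0, ∀ y ∈ (U : Set V), ∀ r, 0 ≤ r → -v r y - ε * Real.exp r < 0 := by
    intro ε hε
    have hd : ∀ y ∈ U, ∀ r, 0 ≤ r → HasDerivWithinAt (fun r => -v r y - ε * Real.exp r)
        (-G.laplacian (v r) y - ε * Real.exp r) (Ici 0) r := fun y hy r hr =>
      (hv y hy r hr).neg.sub ((Real.hasDerivAt_exp r).hasDerivWithinAt.const_mul ε)
    refine neg_of_hasDerivWithinAt_neg_of_first_zero U.finite_toSet
      (fun y r => -v r y - ε * Real.exp r)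
      (fun y hy r hr => (hd y hy r hr).continuousWithinAt) ?_ ?_
    · intro y hy
      have := h0 y hy
      simp only [Real.exp_zero]
      linarith
    · intro y hy r hr hzero hle
      refine ⟨_, hd y hy r hr.le, ?_⟩
      have hpos : 0 < ε * Real.exp r := mul_pos hε (Real.exp_pos r)
      have : 0 ≤ G.laplacian (v r) y := by
        rw [← G.laplacian_const 0 y]
        refine G.laplacian_mono fun z _ => ?_
        by_cases hz : z ∈ U
        · have := hle z hz
          linarith
        · have := hoff z hz r hr.le
          linarith
      linarith
  refine le_of_forall_pos_le_add fun δ hδ => ?_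
  have := key (δ * Real.exp (-t)) (by positivity) x hx t ht
  rw [mul_assoc, ← Real.exp_add, neg_add_cancel, Real.exp_zero] at this
  linarith

/-- The solution `∑_{y ∈ U} p^U_t(x,y) f(y)` of the heat equation with Dirichlet boundary condition on
`U`; it vanishes off `U`. -/
noncomputable def dirichletHeat (U : Finset V) (t : ℝ) (f : V → ℝ) (x : V) : ℝ :=
  ∑ y ∈ U, G.dirichletHeatKernel U t x y * f y

theorem dirichletHeat_of_notMem {U : Finset V} {x : V} (hx : x ∉ U) (t : ℝ) (f : V → ℝ) :
    G.dirichletHeat U t f x = 0 :=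
  Finset.sum_eq_zero fun y _ => by simp [dirichletHeatKernel, hx]

open Classical in
theorem dirichletHeat_of_mem {U : Finset V} {x : V} (hx : x ∈ U) (t : ℝ) (f : V → ℝ) :
    G.dirichletHeat U t f x =
      ∑ y : U, NormedSpace.exp (t • G.dirichletLaplacian U) ⟨x, hx⟩ y * f y := by
  rw [dirichletHeat, ← Finset.sum_coe_sort]
  exact Finset.sum_congr rfl fun y _ => by simp [dirichletHeatKernel, hx]

theorem dirichletHeat_zero {U : Finset V} {x : V} (hx : x ∈ U) (f : V → ℝ) :
    G.dirichletHeat U 0 f x = f x := by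
  classical
  rw [dirichletHeat_of_mem G hx, zero_smul, NormedSpace.exp_zero]
  simp [Matrix.one_apply]

theorem sum_dirichletLaplacian_mul {U : Finset V} {v : V → ℝ} (hv : ∀ y ∉ U, v y = 0) (x : U) :
    ∑ z : U, G.dirichletLaplacian U x z * v z = G.laplacian v x := by
  have h : v = fun y => ∑ z : U, v z * Set.indicator {(z : V)} 1 y := by
    funext y
    by_cases hy : y ∈ U
    · rw [Finset.sum_eq_single (⟨y, hy⟩ : U)]
      · simp
      · intro z _ hz
        have : y ≠ z := fun h => hz (Subtype.ext h.symm)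
        simp [this]
      · simp
    · rw [hv y hy, Finset.sum_eq_zero]
      intro z _
      have : y ≠ z := fun h => hy (h ▸ z.2)
      simp [this]
  conv_rhs => rw [h, laplacian_sum]
  exact Finset.sum_congr rfl fun z _ => by
    rw [laplacian_const_mul, mul_comm]; rfl

attribute [local instance] Matrix.linftyOpNormedRing Matrix.linftyOpNormedAlgebra in
theorem hasDerivAt_dirichletHeat {U : Finset V} {x : V} (hx : x ∈ U) (f : V → ℝ) (t : ℝ) :
    HasDerivAt (fun s => G.dirichletHeat U s f x)
      (G.laplacian (G.dirichletHeat U t f) x) t := by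
  classical
  set A := G.dirichletLaplacian U
  have hA : HasDerivAt (fun s : ℝ => NormedSpace.exp (s • A)) (A * NormedSpace.exp (t • A)) t :=
    hasDerivAt_exp_smul_const' A t
  have hent : ∀ y : U, HasDerivAt (fun s : ℝ => NormedSpace.exp (s • A) ⟨x, hx⟩ y)
      ((A * NormedSpace.exp (t • A)) ⟨x, hx⟩ y) t := fun y =>
    ((Matrix.entryLinearMap ℝ ℝ (⟨x, hx⟩ : U) y).toContinuousLinearMap.hasFDerivAt.comp_hasDerivAt
      t hA)
  have hsum := HasDerivAt.fun_sum (u := Finset.univ) fun y _ => (hent y).mul_const (f y)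
  have hderiv : G.laplacian (G.dirichletHeat U t f) x =
      ∑ y : U, (A * NormedSpace.exp (t • A)) ⟨x, hx⟩ y * f y := by
    rw [← G.sum_dirichletLaplacian_mul (U := U)
      (fun y hy => G.dirichletHeat_of_notMem hy t f) ⟨x, hx⟩]
    simp only [Matrix.mul_apply, Finset.sum_mul]
    rw [Finset.sum_comm]
    refine Finset.sum_congr rfl fun z _ => ?_
    rw [G.dirichletHeat_of_mem z.2, Finset.mul_sum]
    exact Finset.sum_congr rfl fun y _ => (mul_assoc _ _ _).symm
  rw [hderiv, funext fun s => G.dirichletHeat_of_mem hx s f]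
  exact hsum

variable {R : ℕ} {K C t : ℝ} {f : V → ℝ}

theorem dirichletHeat_nonneg (U : Finset V) (hf : ∀ x, 0 ≤ f x) (ht : 0 ≤ t) (x : V) :
    0 ≤ G.dirichletHeat U t f x :=
  G.nonneg_of_heat_equation_on_finset U (fun s => G.dirichletHeat U s f)
    (fun _ hx s _ => (G.hasDerivAt_dirichletHeat hx f s).hasDerivWithinAt)
    (fun _ hx s _ => (G.dirichletHeat_of_notMem hx s f).ge)
    (fun y hy => (hf y).trans_eq (G.dirichletHeat_zero hy f).symm) t ht x

theorem dirichletHeat_le (U : Finset V) (hC : 0 ≤ C) (hf : ∀ x, f x ≤ C) (ht : 0 ≤ t) (x : V) :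
    G.dirichletHeat U t f x ≤ C := by
  rw [← sub_nonneg]
  refine G.nonneg_of_heat_equation_on_finset U (fun s y => C - G.dirichletHeat U s f y)
    (fun y hy s _ => ?_) (fun y hy s _ => ?_) (fun y hy => ?_) t ht x
  · rw [laplacian_sub, laplacian_const]
    exact (hasDerivWithinAt_const _ _ _).sub (G.hasDerivAt_dirichletHeat hy f s).hasDerivWithinAt
  · simpa [G.dirichletHeat_of_notMem hy] using hC
  · simpa [G.dirichletHeat_zero hy] using hf y

theorem dirichletHeat_mono (hf : ∀ x, 0 ≤ f x) (ht : 0 ≤ t) (x : V) :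
    Monotone fun U => G.dirichletHeat U t f x := by
  intro U W hUW
  dsimp only
  rw [← sub_nonneg]
  refine G.nonneg_of_heat_equation_on_finset U
    (fun s y => G.dirichletHeat W s f y - G.dirichletHeat U s f y)
    (fun y hy s _ => ?_) (fun y hy s hs => ?_) (fun y hy => ?_) t ht x
  · rw [laplacian_sub]
    exact ((G.hasDerivAt_dirichletHeat (hUW hy) f s).sub
      (G.hasDerivAt_dirichletHeat hy f s)).hasDerivWithinAt
  · simpa [G.dirichletHeat_of_notMem hy] using G.dirichletHeat_nonneg W hf hs y
  · simp [G.dirichletHeat_zero hy, G.dirichletHeat_zero (hUW hy)]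

/-! ### The minimal heat semigroup -/

open Classical in
theorem dirichletHeat_single (U : Finset V) (t : ℝ) (x y : V) :
    G.dirichletHeat U t (Pi.single y 1) x = G.dirichletHeatKernel U t x y := by
  rw [dirichletHeat, Finset.sum_eq_single y]
  · simp
  · intro z _ hz
    simp [hz]
  · intro hy
    simp [dirichletHeatKernel, hy]

open Classical in
theorem dirichletHeatKernel_mem_Icc (U : Finset V) (ht : 0 ≤ t) (x y : V) :
    G.dirichletHeatKernel U t x y ∈ Icc 0 1 := by
  rw [← dirichletHeat_single]
  refine ⟨G.dirichletHeat_nonneg U (fun z => ?_) ht x,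
    G.dirichletHeat_le U zero_le_one (fun z => ?_) ht x⟩ <;>
  · rw [Pi.single_apply]
    split_ifs <;> norm_num

theorem tendsto_dirichletHeatKernel (ht : 0 ≤ t) (x y : V) :
    Tendsto (fun U => G.dirichletHeatKernel U t x y) atTop (𝓝 (G.heatKernel t x y)) := by
  classical
  refine tendsto_atTop_ciSup ?_
    ⟨1, forall_mem_range.2 fun U => (G.dirichletHeatKernel_mem_Icc U ht x y).2⟩
  simp only [← dirichletHeat_single]
  refine G.dirichletHeat_mono (fun z => ?_) ht x
  rw [Pi.single_apply]
  split_ifs <;> norm_num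

theorem dirichletHeatKernel_le_heatKernel (U : Finset V) (ht : 0 ≤ t) (x y : V) :
    G.dirichletHeatKernel U t x y ≤ G.heatKernel t x y :=
  le_ciSup (f := fun U => G.dirichletHeatKernel U t x y)
    ⟨1, forall_mem_range.2 fun U => (G.dirichletHeatKernel_mem_Icc U ht x y).2⟩ U

/-- `P_t f` is the limit of the Dirichlet heat flows, by monotone convergence. -/
theorem tendsto_dirichletHeat (hf : ∀ x, 0 ≤ f x) (hC : ∀ x, f x ≤ C) (ht : 0 ≤ t) (x : V) :
    Tendsto (fun U => G.dirichletHeat U t f x) atTop (𝓝 (G.heat t f x)) := by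
  have hC0 : 0 ≤ C := (hf x).trans (hC x)
  have hbdd : BddAbove (range fun U => G.dirichletHeat U t f x) :=
    ⟨C, forall_mem_range.2 fun U => G.dirichletHeat_le U hC0 hC ht x⟩
  have hlim := tendsto_atTop_ciSup (G.dirichletHeat_mono hf ht x) hbdd
  have hk : ∀ y, 0 ≤ G.heatKernel t x y * f y := fun y => mul_nonneg
    ((G.dirichletHeatKernel_mem_Icc ∅ ht x y).1.trans
      (G.dirichletHeatKernel_le_heatKernel ∅ ht x y)) (hf y)
  have hpart : ∀ F : Finset V,
      ∑ y ∈ F, G.heatKernel t x y * f y ≤ ⨆ U, G.dirichletHeat U t f x := by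
    intro F
    refine le_of_tendsto (tendsto_finsetSum F fun y _ =>
      (G.tendsto_dirichletHeatKernel ht x y).mul_const (f y)) ?_
    filter_upwards [eventually_ge_atTop F] with U hU
    refine le_trans ?_ (le_ciSup hbdd U)
    exact Finset.sum_le_sum_of_subset_of_nonneg hU fun y _ _ =>
      mul_nonneg (G.dirichletHeatKernel_mem_Icc U ht x y).1 (hf y)
  have hsum : Summable fun y => G.heatKernel t x y * f y := summable_of_sum_le hk hpart
  have heq : G.heat t f x = ⨆ U, G.dirichletHeat U t f x := by
    refine le_antisymm (hsum.tsum_le_of_sum_le hpart) (ciSup_le fun U => ?_)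
    refine le_trans (Finset.sum_le_sum fun y _ => ?_) (hsum.sum_le_tsum U fun y _ => hk y)
    exact mul_le_mul_of_nonneg_right (G.dirichletHeatKernel_le_heatKernel U ht x y) (hf y)
  rwa [heq]

theorem heat_nonneg (hf : ∀ x, 0 ≤ f x) (hC : ∀ x, f x ≤ C) (ht : 0 ≤ t) (x : V) :
    0 ≤ G.heat t f x :=
  ge_of_tendsto' (G.tendsto_dirichletHeat hf hC ht x) fun U => G.dirichletHeat_nonneg U hf ht x

theorem heat_le (hf : ∀ x, 0 ≤ f x) (hC : ∀ x, f x ≤ C) (ht : 0 ≤ t) (x : V) :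
    G.heat t f x ≤ C :=
  le_of_tendsto' (G.tendsto_dirichletHeat hf hC ht x) fun U =>
    G.dirichletHeat_le U ((hf x).trans (hC x)) hC ht x

theorem heat_zero (hf : ∀ x, 0 ≤ f x) (hC : ∀ x, f x ≤ C) (x : V) : G.heat 0 f x = f x := by
  refine tendsto_nhds_unique (G.tendsto_dirichletHeat hf hC le_rfl x)
    (tendsto_const_nhds.congr' ?_)
  filter_upwards [eventually_ge_atTop {x}] with U hU
  exact (G.dirichletHeat_zero (hU (Finset.mem_singleton_self x)) f).symm

/-- `P_t f` solves the heat equation pointwise on `[0, ∞)`. Near a fixed vertex the second time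
derivatives of the Dirichlet flows are bounded uniformly in the finite set, so their Taylor estimates
pass to the limit. -/
theorem hasDerivWithinAt_heat (hf : ∀ x, 0 ≤ f x) (hC : ∀ x, f x ≤ C) (ht : 0 ≤ t) (x : V) :
    HasDerivWithinAt (fun s => G.heat s f x) (G.laplacian (G.heat t f) x) (Ici 0) t := by
  classical
  have hC0 : 0 ≤ C := (hf x).trans (hC x)
  set N := insert x (G.nbrs x)
  set B := ∑ z ∈ N, 2 * G.deg z * C
  refine hasDerivWithinAt_of_abs_sub_sub_mul_le (L := 2 * G.deg x * B) fun s hs => ?_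
  have hlap : Tendsto (fun U => G.laplacian (G.dirichletHeat U t f) x) atTop
      (𝓝 (G.laplacian (G.heat t f) x)) :=
    G.tendsto_laplacian (G.tendsto_dirichletHeat hf hC ht x)
      fun z _ => G.tendsto_dirichletHeat hf hC ht z
  refine le_of_tendsto (((G.tendsto_dirichletHeat hf hC hs x).sub
    (G.tendsto_dirichletHeat hf hC ht x)).sub (hlap.const_mul (s - t))).abs ?_
  filter_upwards [eventually_ge_atTop N] with U hU
  have hd : ∀ z ∈ N, ∀ r, HasDerivWithinAt (fun r => G.dirichletHeat U r f z)
      (G.laplacian (G.dirichletHeat U r f) z) (Ici 0) r := fun z hz r =>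
    (G.hasDerivAt_dirichletHeat (hU hz) f r).hasDerivWithinAt
  have hB : ∀ r ∈ Ici (0 : ℝ), ∀ z ∈ N, |G.laplacian (G.dirichletHeat U r f) z| ≤ B := by
    intro r hr z hz
    have habs : ∀ y, |G.dirichletHeat U r f y| ≤ C := fun y => by
      rw [abs_of_nonneg (G.dirichletHeat_nonneg U hf hr y)]
      exact G.dirichletHeat_le U hC0 hC hr y
    refine (G.abs_laplacian_le (habs z) fun y _ => habs y).trans ?_
    refine Finset.single_le_sum (f := fun z => 2 * G.deg z * C) (fun y _ => ?_) hz
    have := G.deg_nonneg y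
    positivity
  have hx : x ∈ N := Finset.mem_insert_self x _
  have hz : ∀ z ∈ G.nbrs x, z ∈ N := fun z hz => Finset.mem_insert_of_mem hz
  refine abs_sub_sub_mul_le_of_abs_second_deriv_le
    (φ'' := fun r => G.laplacian (G.laplacian (G.dirichletHeat U r f)) x)
    (fun r _ => hd x hx r) (fun r _ => ?_) (fun r hr => ?_) hs ht
  · exact G.hasDerivWithinAt_laplacian (v := fun r => G.dirichletHeat U r f)
      (v' := fun r => G.laplacian (G.dirichletHeat U r f)) (hd x hx r) fun z h => hd z (hz z h) r
  · exact G.abs_laplacian_le (hB r hr x hx) fun z h => hB r hr z (hz z h)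

theorem heat_pos (hf : ∀ x, 0 < f x) (hC : ∀ x, f x ≤ C) (ht : 0 ≤ t) (x : V) :
    0 < G.heat t f x := by
  have hf' : ∀ x, 0 ≤ f x := fun x => (hf x).le
  have hd : ∀ s ∈ Ici (0 : ℝ), HasDerivWithinAt (fun s => Real.exp (G.deg x * s) * G.heat s f x)
      (Real.exp (G.deg x * s) * (G.deg x * G.heat s f x + G.laplacian (G.heat s f) x))
      (Ici 0) s := by
    intro s hs
    convert! (((hasDerivAt_id s).const_mul (G.deg x)).exp.hasDerivWithinAt).mul
      (G.hasDerivWithinAt_heat hf' hC hs x) using 1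
    simp only [id]
    ring
  have hmono : MonotoneOn (fun s => Real.exp (G.deg x * s) * G.heat s f x) (Ici 0) := by
    refine monotoneOn_of_hasDerivWithinAt_nonneg (convex_Ici 0)
      (fun s hs => (hd s hs).continuousWithinAt)
      (fun s hs => (hd s (interior_subset hs)).mono interior_subset) fun s hs => ?_
    have := G.neg_deg_mul_le_laplacian (fun z => G.heat_nonneg hf' hC (interior_subset hs) z) x
    exact mul_nonneg (Real.exp_pos _).le (by linarith)
  have h := hmono self_mem_Ici ht ht
  simp only [mul_zero, Real.exp_zero, one_mul, G.heat_zero hf' hC] at h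
  exact pos_of_mul_pos_right ((hf x).trans_le h) (Real.exp_pos _).le

/-! ### The gradient and the curvature -/

theorem abs_sub_le_rGradient (f : V → ℝ) {x y : V} (hy : y ∈ G.ball R x) :
    |f y - f x| ≤ G.rGradient R f x :=
  (G.rGradient_isGreatest R f x).2 ⟨y, hy, rfl⟩

theorem exists_abs_sub_eq_rGradient (R : ℕ) (f : V → ℝ) (x : V) :
    ∃ y ∈ G.ball R x, |f y - f x| = G.rGradient R f x :=
  (G.rGradient_isGreatest R f x).1

theorem rGradient_nonneg (f : V → ℝ) (x : V) : 0 ≤ G.rGradient R f x := by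
  obtain ⟨y, _, hy⟩ := G.exists_abs_sub_eq_rGradient R f x
  exact hy ▸ abs_nonneg _

theorem rGradient_congr {f g : V → ℝ} {x : V} (h : ∀ y ∈ G.ball R x, f y = g y) :
    G.rGradient R f x = G.rGradient R g x := by
  unfold rGradient
  exact iSup_congr fun y => by rw [h y y.2, h x (G.mem_ball_self R x)]

theorem rGradient_const_mul {c : ℝ} (hc : 0 ≤ c) (f : V → ℝ) (x : V) :
    G.rGradient R (fun z => c * f z) x = c * G.rGradient R f x := by
  unfold rGradient
  rw [Real.mul_iSup_of_nonneg hc]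
  exact iSup_congr fun y => by rw [← mul_sub, abs_mul, abs_of_nonneg hc]

/-- The gradient of the square root of a function with values in `[0, C]` is at most `√C`. -/
theorem rGradient_sqrt_sq_le {f : V → ℝ} {C : ℝ} (hf : ∀ x, 0 ≤ f x) (hC : ∀ x, f x ≤ C) (x : V) :
    G.rGradient R (fun z => √(f z)) x ^ 2 ≤ C := by
  obtain ⟨y, _, hy⟩ := G.exists_abs_sub_eq_rGradient R (fun z => √(f z)) x
  rw [← Real.sq_sqrt ((hf x).trans (hC x)), ← hy]
  refine pow_le_pow_left₀ (abs_nonneg _) ?_ 2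
  have h1 := Real.sqrt_le_sqrt (hC x)
  have h2 := Real.sqrt_le_sqrt (hC y)
  have h3 := Real.sqrt_nonneg (f x)
  have h4 := Real.sqrt_nonneg (f y)
  rw [abs_le]
  constructor <;> linarith

theorem coe_le_half_mul_iff (K : ℝ) (I : EReal) :
    (K : EReal) ≤ ((1 / 2 : ℝ) : EReal) * I ↔ ((2 * K : ℝ) : EReal) ≤ I := by
  constructor <;> intro h
  · have := mul_le_mul_of_nonneg_left h (show (0 : EReal) ≤ ((2 : ℝ) : EReal) by norm_num)
    rwa [← mul_assoc, ← EReal.coe_mul, ← EReal.coe_mul, mul_one_div_cancel two_ne_zero,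
      EReal.coe_one, one_mul] at this
  · have := mul_le_mul_of_nonneg_left h
      (show (0 : EReal) ≤ ((1 / 2 : ℝ) : EReal) from EReal.coe_nonneg.2 (by norm_num))
    rwa [← EReal.coe_mul, show (1 / 2 : ℝ) * (2 * K) = K by ring] at this

/-- For the test functions of `K^q_R(x,y)` the sign of `g y - g x` is `g y - g x` itself. -/
theorem le_quadraticCurvature_iff {K : ℝ} {x y : V} :
    (K : EReal) ≤ G.quadraticCurvature R x y ↔
      ∀ g : V → ℝ, (∀ z, 0 < g z) → G.rGradient R g x = 1 → |g y - g x| = 1 →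
        2 * K ≤ G.laplacian (fun z => G.rGradient R g z ^ 2) x - (g y - g x) *
          (G.laplacian (fun z => g z ^ 2) y / g y - G.laplacian (fun z => g z ^ 2) x / g x) := by
  have hsign : ∀ a : ℝ, |a| = 1 → Real.sign a = a := by
    intro a ha
    rcases eq_or_eq_neg_of_abs_eq ha with h | h <;> simp [h, Real.sign_of_neg]
  rw [quadraticCurvature, coe_le_half_mul_iff]
  simp only [le_iInf_iff, mem_ofPred_eq, and_imp, EReal.coe_le_coe_iff]
  refine forall_congr' fun g => forall₃_congr fun _ _ h => ?_
  rw [hsign _ h]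

/-- The curvature inequality in homogeneous form: the gradient at `x` need not be normalized. -/
theorem two_mul_mul_sq_le_of_le_quadraticCurvature {K : ℝ} {x y : V}
    (hK : (K : EReal) ≤ G.quadraticCurvature R x y) {g : V → ℝ} (hg : ∀ z, 0 < g z)
    (hy : |g y - g x| = G.rGradient R g x) (hne : g y ≠ g x) :
    2 * K * (g y - g x) ^ 2 ≤ G.laplacian (fun z => G.rGradient R g z ^ 2) x - (g y - g x) *
      (G.laplacian (fun z => g z ^ 2) y / g y - G.laplacian (fun z => g z ^ 2) x / g x) := by
  have hpos : 0 < |g y - g x| := abs_pos.2 (sub_ne_zero.2 hne)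
  set c := |g y - g x|⁻¹ with hc
  have hc0 : 0 < c := inv_pos.2 hpos
  have hc1 : c * |g y - g x| = 1 := inv_mul_cancel₀ hpos.ne'
  have h := G.le_quadraticCurvature_iff.1 hK (fun z => c * g z) (fun z => mul_pos hc0 (hg z))
    (by rw [G.rGradient_const_mul hc0.le, ← hy, hc1])
    (by rw [← mul_sub, abs_mul, abs_of_pos hc0, hc1])
  simp only [G.rGradient_const_mul hc0.le, mul_pow, G.laplacian_const_mul] at h
  have hx0 := (hg x).ne'
  have hy0 := (hg y).ne'
  have e1 : ∀ z, c ^ 2 * G.laplacian (fun z => g z ^ 2) z / (c * g z) =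
      c * (G.laplacian (fun z => g z ^ 2) z / g z) := by
    intro z
    have := (hg z).ne'
    have := hc0.ne'
    field_simp
  rw [e1, e1] at h
  have h2 := mul_le_mul_of_nonneg_left h (sq_nonneg (g y - g x))
  have e2 : c ^ 2 * (g y - g x) ^ 2 = 1 := by
    rw [← sq_abs (g y - g x), ← mul_pow, hc1, one_pow]
  calc 2 * K * (g y - g x) ^ 2 = (g y - g x) ^ 2 * (2 * K) := by ring
    _ ≤ _ := h2
    _ = c ^ 2 * (g y - g x) ^ 2 * (G.laplacian (fun z => G.rGradient R g z ^ 2) x - (g y - g x) *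
      (G.laplacian (fun z => g z ^ 2) y / g y - G.laplacian (fun z => g z ^ 2) x / g x)) := by ring
    _ = _ := by rw [e2, one_mul]

/-! ### Laplacian comparison for the rescaled distance -/

theorem reachable_of_mem_ball {x y : V} (h : y ∈ G.ball R x) : G.toSimpleGraph.Reachable x y :=
  SimpleGraph.reachable_of_edist_ne_top (ne_top_of_le_ne_top (ENat.natCast_ne_top R) h)

theorem dist_le_of_mem_ball {x y : V} (h : y ∈ G.ball R x) : G.toSimpleGraph.dist x y ≤ R := by
  have h' : G.toSimpleGraph.edist x y ≤ R := h
  rw [← (G.reachable_of_mem_ball h).coe_dist_eq_edist] at h'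
  exact_mod_cast h'

theorem mem_ball_of_walk {x y : V} (p : G.toSimpleGraph.Walk x y) (hp : p.length ≤ R) :
    y ∈ G.ball R x :=
  (SimpleGraph.edist_le p).trans (by exact_mod_cast hp)

theorem mem_ball_comm {x y : V} : y ∈ G.ball R x ↔ x ∈ G.ball R y := by
  simp only [ball, d, mem_ofPred_eq, SimpleGraph.edist_comm]

theorem reachable_of_mem_nbrs {x z : V} (hz : z ∈ G.nbrs x) : G.toSimpleGraph.Reachable x z := by
  by_cases h : x = z
  · rw [h]
  · exact SimpleGraph.Adj.reachable (show x ≠ z ∧ 0 < G.w x z from ⟨h, G.mem_nbrs.1 hz⟩)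

/-- `⌈dist(o,x) / R⌉`, the distance from `o` in the metric whose unit balls are the `R`-balls;
zero off the connected component of `o`. -/
noncomputable def radial (R : ℕ) (o x : V) : ℕ := (G.toSimpleGraph.dist o x + R - 1) / R

theorem radial_le_add_one (hR : 0 < R) (o : V) {x y : V} (h : y ∈ G.ball R x) :
    G.radial R o y ≤ G.radial R o x + 1 := by
  have hd : G.toSimpleGraph.dist o y ≤ G.toSimpleGraph.dist o x + R := by
    by_cases hr : G.toSimpleGraph.Reachable o x
    · exact (hr.dist_triangle_left y).trans (Nat.add_le_add_left (G.dist_le_of_mem_ball h) _)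
    · rw [SimpleGraph.dist_eq_zero_of_not_reachable
        fun h' => hr (h'.trans (G.reachable_of_mem_ball h).symm)]
      exact Nat.zero_le _
  unfold radial
  rw [← Nat.add_div_right _ hR]
  exact Nat.div_le_div_right (by omega)

theorem dist_le_mul_radial (hR : 0 < R) (o x : V) :
    G.toSimpleGraph.dist o x ≤ R * G.radial R o x := by
  have := Nat.lt_mul_div_succ (G.toSimpleGraph.dist o x + R - 1) hR
  rw [Nat.mul_add] at this
  unfold radial
  omega

theorem exists_radial_le_of_radial_eq_add_one (hR : 0 < R) {o x : V} {n : ℕ}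
    (hx : G.toSimpleGraph.Reachable o x) (hn : G.radial R o x = n + 1) :
    ∃ y, G.toSimpleGraph.Reachable o y ∧ G.radial R o y ≤ n ∧ x ∈ G.ball R y := by
  obtain ⟨p, hp⟩ := hx.exists_walk_length_eq_dist
  have hle := G.dist_le_mul_radial hR o x
  rw [hn, mul_add, mul_one] at hle
  refine ⟨p.getVert (R * n), (p.take (R * n)).reachable, ?_,
    G.mem_ball_of_walk (p.drop (R * n)) (by rw [SimpleGraph.Walk.drop_length]; omega)⟩
  have hd : G.toSimpleGraph.dist o (p.getVert (R * n)) ≤ R * n :=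
    (SimpleGraph.dist_le (p.take (R * n))).trans (by simp)
  unfold radial
  rw [← Nat.lt_succ_iff, Nat.div_lt_iff_lt_mul hR, Nat.succ_mul, mul_comm n]
  omega

/-- For an `R`-Lipschitz function the quadratic curvature bound implies a bound on the Laplacians at the
two ends of a pair where the function grows at full speed. The curvature is tested with `h + c` as
`c → ∞`, where `Δ(h + c)² / (h + c)` tends to `2 Δh`. -/
theorem laplacian_le_sub_of_le_quadraticCurvature {K : ℝ} {x y : V}
    (hK : (K : EReal) ≤ G.quadraticCurvature R x y) (hxy : y ∈ G.ball R x) {h : V → ℝ}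
    (h0 : ∀ z, 0 ≤ h z) (hlip : ∀ z, ∀ z' ∈ G.ball R z, |h z' - h z| ≤ 1) (hstep : h y = h x + 1) :
    G.laplacian h y ≤ G.laplacian h x - K := by
  have hgrad : ∀ c z, G.rGradient R (fun v => h v + c) z ≤ 1 := by
    intro c z
    obtain ⟨z', hz', he⟩ := G.exists_abs_sub_eq_rGradient R (fun v => h v + c) z
    rw [← he, add_sub_add_right_eq_sub]
    exact hlip z z' hz'
  -- the quadratic part of `Δ(h + c)²`
  let E : V → ℝ := fun v => G.laplacian (fun z => (h z - h v) ^ 2) v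
  have hE : ∀ v, 0 ≤ E v := by
    intro v
    have : G.laplacian (fun _ => 0) v ≤ E v := G.laplacian_mono fun z _ => by
      simpa using sq_nonneg (h z - h v)
    rwa [G.laplacian_const] at this
  have hsq : ∀ c v, G.laplacian (fun z => (h z + c) ^ 2) v =
      2 * (h v + c) * G.laplacian h v + E v := by
    intro c v
    have : (fun z => (h z + c) ^ 2) = fun z =>
        (2 * (h v + c) * h z + (h z - h v) ^ 2) + ((h v + c) ^ 2 - 2 * (h v + c) * h v) := by
      funext z; ring
    rw [this, G.laplacian_add, G.laplacian_const, G.laplacian_add, G.laplacian_const_mul, add_zero]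
  have hc : ∀ c > 0, 2 * K + 2 * G.laplacian h y - 2 * G.laplacian h x ≤ E x / (h x + c) := by
    intro c hc
    have hpos : ∀ z, 0 < h z + c := fun z => add_pos_of_nonneg_of_pos (h0 z) hc
    have h1 : |(h y + c) - (h x + c)| = 1 := by rw [hstep]; simp [add_sub_add_right_eq_sub]
    have hx1 : G.rGradient R (fun v => h v + c) x = 1 :=
      le_antisymm (hgrad c x) (h1 ▸ G.abs_sub_le_rGradient (fun v => h v + c) hxy)
    have h2 := G.le_quadraticCurvature_iff.1 hK (fun z => h z + c) hpos hx1 h1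
    have h3 : G.laplacian (fun z => G.rGradient R (fun v => h v + c) z ^ 2) x ≤ 0 := by
      rw [← G.laplacian_const 0 x]
      refine G.laplacian_mono fun z _ => ?_
      have := pow_le_one₀ (n := 2) (G.rGradient_nonneg (fun v => h v + c) z) (hgrad c z)
      rw [hx1]
      linarith
    have e : ∀ v, (2 * (h v + c) * G.laplacian h v + E v) / (h v + c) =
        2 * G.laplacian h v + E v / (h v + c) := by
      intro v
      have := (hpos v).ne'
      field_simp
    rw [hsq, hsq, e, e, show h y + c - (h x + c) = 1 by rw [hstep]; ring, one_mul] at h2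
    have h4 : 0 ≤ E y / (h y + c) := div_nonneg (hE y) (hpos y).le
    linarith
  have hlim : Tendsto (fun c => E x / (h x + c)) atTop (𝓝 0) :=
    (tendsto_atTop_add_const_left atTop (h x) tendsto_id).const_div_atTop (E x)
  have := ge_of_tendsto hlim ((eventually_gt_atTop 0).mono hc)
  linarith

/-- Summing the two-point bound along a geodesic from `o`. -/
theorem laplacian_radial_le {K : ℝ} (hR : 0 < R)
    (hK : ∀ x y : V, G.d x y ≤ R → (K : EReal) ≤ G.quadraticCurvature R x y) {o x : V}
    (hx : G.toSimpleGraph.Reachable o x) :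
    G.laplacian (fun z => (G.radial R o z : ℝ)) x ≤
      G.laplacian (fun z => (G.radial R o z : ℝ)) o - K * G.radial R o x := by
  induction hn : G.radial R o x generalizing x with
  | zero =>
    have hle := G.dist_le_mul_radial hR o x
    rw [hn, mul_zero, Nat.le_zero, hx.dist_eq_zero_iff] at hle
    simp [hle]
  | succ n ih =>
    obtain ⟨y, hoy, hyn, hxy⟩ := G.exists_radial_le_of_radial_eq_add_one hR hx hn
    have hyx := G.radial_le_add_one hR o hxy
    have hy : G.radial R o y = n := by omega
    have h := G.laplacian_le_sub_of_le_quadraticCurvature (hK y x hxy) hxy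
      (h := fun z => (G.radial R o z : ℝ)) (fun z => Nat.cast_nonneg _) (fun z z' hz => by
        have h1 : (G.radial R o z' : ℝ) ≤ G.radial R o z + 1 := by
          exact_mod_cast G.radial_le_add_one hR o hz
        have h2 : (G.radial R o z : ℝ) ≤ G.radial R o z' + 1 := by
          exact_mod_cast G.radial_le_add_one hR o (G.mem_ball_comm.1 hz)
        rw [abs_le]
        constructor <;> linarith) (by rw [hn, hy]; push_cast; rfl)
    have := ih hoy hy
    push_cast
    linarith

/-! ### Evolution of the squared differences of `√(P_t f)` -/

theorem hasDerivWithinAt_sq_sqrt_heat_sub (hf : ∀ x, 0 < f x) (hC : ∀ x, f x ≤ C) (x y : V)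
    {t : ℝ} (ht : 0 ≤ t) :
    HasDerivWithinAt (fun s => (√(G.heat s f y) - √(G.heat s f x)) ^ 2)
      ((√(G.heat t f y) - √(G.heat t f x)) *
        (G.laplacian (G.heat t f) y / √(G.heat t f y) -
          G.laplacian (G.heat t f) x / √(G.heat t f x))) (Ici 0) t := by
  have hd : ∀ z, HasDerivWithinAt (fun s => √(G.heat s f z))
      (G.laplacian (G.heat t f) z / (2 * √(G.heat t f z))) (Ici 0) t := fun z =>
    (G.hasDerivWithinAt_heat (fun z => (hf z).le) hC ht z).sqrt (G.heat_pos hf hC ht z).ne'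
  convert! ((hd y).fun_sub (hd x)).fun_pow 2 using 1
  have hx := (Real.sqrt_pos.2 (G.heat_pos hf hC ht x)).ne'
  have hy := (Real.sqrt_pos.2 (G.heat_pos hf hC ht y)).ne'
  push_cast
  field_simp

/-! ### Curvature bound and gradient estimate -/

/-- The gradient estimate up to an error `ε e^{λt} (1 + r)`, where `r` is the distance from `o` and `λ`
is large. The error dominates everything outside a finite ball around `o`, and as `Δr ≤ Δr(o) - K r`
it is a strict supersolution of the heat equation, so the first-touch principle applies. -/
theorem exp_mul_rGradient_sq_sub_heat_lt (hR : 0 < R)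
    (hK : ∀ x y : V, G.d x y ≤ R → (K : EReal) ≤ G.quadraticCurvature R x y)
    (hf : ∀ x, 0 < f x) (hC : ∀ x, f x ≤ C) (o : V) :
    ∃ lam : ℝ, ∀ ε > 0, ∀ t, 0 ≤ t →
      Real.exp (2 * K * t) * G.rGradient R (fun z => √(G.heat t f z)) o ^ 2 -
        G.heat t (fun z => G.rGradient R (fun v => √(f v)) z ^ 2) o < ε * Real.exp (lam * t) := by
  have hf' : ∀ x, 0 ≤ f x := fun x => (hf x).le
  set F₀ : V → ℝ := fun z => G.rGradient R (fun v => √(f v)) z ^ 2 with hF₀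
  have hF₀0 : ∀ z, 0 ≤ F₀ z := fun z => sq_nonneg _
  have hF₀C : ∀ z, F₀ z ≤ C := fun z => G.rGradient_sqrt_sq_le hf' hC z
  set u : ℝ → V → ℝ := fun t z => √(G.heat t f z) with hu
  have hupos : ∀ t, 0 ≤ t → ∀ z, 0 < u t z := fun t ht z =>
    Real.sqrt_pos.2 (G.heat_pos hf hC ht z)
  have husq : ∀ t, 0 ≤ t → (fun z => u t z ^ 2) = G.heat t f := fun t ht => by
    funext z
    exact Real.sq_sqrt (G.heat_nonneg hf' hC ht z)
  set r : V → ℝ := fun z => (G.radial R o z : ℝ) with hr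
  have hr0 : ∀ z, 0 ≤ r z := fun z => Nat.cast_nonneg _
  set lam : ℝ := 2 * |K| + |G.laplacian r o| + 1 with hlam
  have hKabs := le_abs_self K
  have hKabs' := neg_abs_le K
  have hΔr : ∀ z, G.toSimpleGraph.Reachable o z → G.laplacian r z < lam * (1 + r z) := by
    intro z hz
    have h1 : G.laplacian r z ≤ G.laplacian r o - K * r z := G.laplacian_radial_le hR hK hz
    have h2 := le_abs_self (G.laplacian r o)
    have h3 := mul_nonneg (abs_nonneg (G.laplacian r o)) (hr0 z)
    have h4 := mul_nonneg (abs_nonneg K) (hr0 z)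
    have h5 := mul_le_mul_of_nonneg_right hKabs' (hr0 z)
    have h6 := abs_nonneg K
    have h7 := hr0 z
    rw [hlam]
    nlinarith
  refine ⟨lam, fun ε hε t₀ ht₀ => ?_⟩
  set D : V × V → ℝ → ℝ := fun p t =>
    Real.exp (2 * K * t) * (u t p.2 - u t p.1) ^ 2 - G.heat t F₀ p.1 -
      ε * (1 + r p.1) * Real.exp (lam * t) with hD
  obtain ⟨n, hn⟩ := exists_nat_gt (R * (C / ε))
  set s : Set (V × V) := {p | p.1 ∈ G.ball n o ∧ p.2 ∈ G.ball R p.1} with hs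
  have hsfin : s.Finite := by
    refine ((G.ball_finite n o).biUnion fun x _ =>
      (G.ball_finite R x).image (Prod.mk x)).subset ?_
    rintro ⟨x, y⟩ ⟨hx, hy⟩
    exact mem_biUnion hx ⟨y, hy, rfl⟩
  -- off the ball the error term alone exceeds the bounded gradient
  have hoff : ∀ z, G.toSimpleGraph.Reachable o z → z ∉ G.ball n o → C ≤ ε * (1 + r z) := by
    intro z hz hzn
    have hdist : n < G.toSimpleGraph.dist o z := by
      by_contra! h
      refine hzn (show G.toSimpleGraph.edist o z ≤ n from ?_)
      rw [← hz.coe_dist_eq_edist]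
      exact_mod_cast h
    have h1 : (n : ℝ) < R * r z := by
      change (n : ℝ) < R * (G.radial R o z : ℝ)
      exact_mod_cast hdist.trans_le (G.dist_le_mul_radial hR o z)
    have h2 : C / ε < r z := lt_of_mul_lt_mul_left (hn.trans h1) (Nat.cast_nonneg R)
    rw [div_lt_iff₀' hε] at h2
    linarith
  have hgap : ∀ t, 0 ≤ t → (∀ p ∈ s, D p t ≤ 0) → ∀ z, G.toSimpleGraph.Reachable o z →
      Real.exp (2 * K * t) * G.rGradient R (u t) z ^ 2 ≤
        G.heat t F₀ z + ε * (1 + r z) * Real.exp (lam * t) := by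
    intro t ht hle z hz
    by_cases hzn : z ∈ G.ball n o
    · obtain ⟨y, hy, he⟩ := G.exists_abs_sub_eq_rGradient R (u t) z
      have h := hle (z, y) ⟨hzn, hy⟩
      rw [← he, sq_abs]
      simp only [hD] at h
      linarith
    · have h1 : G.rGradient R (u t) z ^ 2 ≤ C :=
        G.rGradient_sqrt_sq_le (fun z => G.heat_nonneg hf' hC ht z) (G.heat_le hf' hC ht) z
      have h2 : Real.exp (2 * K * t) ≤ Real.exp (lam * t) := by
        refine Real.exp_le_exp.2 (mul_le_mul_of_nonneg_right ?_ ht)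
        have := abs_nonneg (G.laplacian r o)
        linarith
      have h3 := G.heat_nonneg hF₀0 hF₀C ht z
      have h4 := mul_le_mul h2 (h1.trans (hoff z hz hzn)) (sq_nonneg _) (Real.exp_pos _).le
      linarith
  have hDd : ∀ p t, 0 ≤ t → HasDerivWithinAt (D p)
      (2 * K * (Real.exp (2 * K * t) * (u t p.2 - u t p.1) ^ 2) +
        Real.exp (2 * K * t) * ((u t p.2 - u t p.1) *
          (G.laplacian (G.heat t f) p.2 / u t p.2 - G.laplacian (G.heat t f) p.1 / u t p.1)) -
        G.laplacian (G.heat t F₀) p.1 - ε * (1 + r p.1) * (lam * Real.exp (lam * t)))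
      (Ici 0) t := by
    intro p t ht
    have he : ∀ c : ℝ, HasDerivWithinAt (fun s => Real.exp (c * s)) (c * Real.exp (c * t))
        (Ici 0) t := fun c => by
      simpa [mul_comm] using ((hasDerivAt_id t).const_mul c).exp.hasDerivWithinAt (s := Ici 0)
    convert! (((he (2 * K)).fun_mul
      (G.hasDerivWithinAt_sq_sqrt_heat_sub hf hC p.1 p.2 ht)).fun_sub
      (G.hasDerivWithinAt_heat hF₀0 hF₀C ht p.1)).fun_sub
      ((he lam).const_mul (ε * (1 + r p.1))) using 1
    ring
  have hneg := neg_of_hasDerivWithinAt_neg_of_first_zero hsfin D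
    (fun p _ t ht => (hDd p t ht).continuousWithinAt) ?_ ?_
  · have h1 := hgap t₀ ht₀ (fun p hp => (hneg p hp t₀ ht₀).le) o (SimpleGraph.Reachable.refl o)
    obtain ⟨y, hy, he⟩ := G.exists_abs_sub_eq_rGradient R (u t₀) o
    have h2 := hneg (o, y) ⟨G.mem_ball_self n o, hy⟩ t₀ ht₀
    have hro : r o = 0 := by
      simp [hr, radial, Nat.div_eq_of_lt (Nat.sub_lt hR one_pos)]
    simp only [hD, hro, add_zero, mul_one] at h2
    rw [← he, sq_abs]
    linarith
  · rintro ⟨x, y⟩ ⟨-, hy⟩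
    have h1 : (u 0 y - u 0 x) ^ 2 ≤ F₀ x := by
      simp only [hu, G.heat_zero hf' hC, hF₀]
      rw [← sq_abs]
      exact pow_le_pow_left₀ (abs_nonneg _) (G.abs_sub_le_rGradient (fun v => √(f v)) hy) 2
    have h2 : 0 < ε * (1 + r x) := mul_pos hε (by linarith [hr0 x])
    simp only [hD, mul_zero, Real.exp_zero, one_mul, mul_one, G.heat_zero hF₀0 hF₀C]
    linarith
  · rintro ⟨x, y⟩ ⟨hx, hy⟩ t ht hzero hle
    refine ⟨_, hDd (x, y) t ht.le, ?_⟩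
    have hox : G.toSimpleGraph.Reachable o x := G.reachable_of_mem_ball hx
    have hErr : 0 < ε * Real.exp (lam * t) := mul_pos hε (Real.exp_pos _)
    have hexp : 0 < Real.exp (2 * K * t) := Real.exp_pos _
    have hH := G.heat_nonneg hF₀0 hF₀C ht.le x
    simp only [hD] at hzero
    -- `y` realizes the gradient of `u t` at `x`, and `u t y ≠ u t x` since the error is positive
    have hmax := hgap t ht.le hle x hox
    have habs : |u t y - u t x| = G.rGradient R (u t) x := by
      refine le_antisymm (G.abs_sub_le_rGradient (u t) hy) ((le_abs_self _).trans (sq_le_sq.1 ?_))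
      exact le_of_mul_le_mul_left (by linarith) hexp
    have hne : u t y ≠ u t x := by
      intro h
      rw [h, sub_self] at hzero
      have : 0 < ε * (1 + r x) * Real.exp (lam * t) := by
        have := hr0 x
        positivity
      linarith
    have hcurv := G.two_mul_mul_sq_le_of_le_quadraticCurvature (hK x y hy) (hupos t ht.le) habs hne
    rw [husq t ht.le] at hcurv
    -- the function `e^{2Kt} |∇u|² - P_t F₀ - ε e^{λt} (1 + r)` is maximal at `x`
    have hlap : Real.exp (2 * K * t) * G.laplacian (fun z => G.rGradient R (u t) z ^ 2) x ≤
        G.laplacian (G.heat t F₀) x + ε * Real.exp (lam * t) * G.laplacian r x := by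
      rw [← G.laplacian_const_mul, ← G.laplacian_const_mul, ← G.laplacian_add]
      refine G.laplacian_mono fun z hz => ?_
      have h1 := hgap t ht.le hle z (hox.trans (G.reachable_of_mem_nbrs hz))
      rw [← habs, sq_abs]
      linarith
    have h1 := mul_le_mul_of_nonneg_left hcurv hexp.le
    have h2 := mul_lt_mul_of_pos_left (hΔr x hox) hErr
    simp only
    linarith

theorem rGradient_sqrt_heat_sq_le (hR : 0 < R)
    (hK : ∀ x y : V, G.d x y ≤ R → (K : EReal) ≤ G.quadraticCurvature R x y)
    (hf : ∀ x, 0 < f x) (hC : ∀ x, f x ≤ C) {t : ℝ} (ht : 0 ≤ t) (x : V) :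
    G.rGradient R (fun z => √(G.heat t f z)) x ^ 2 ≤
      Real.exp (-2 * K * t) * G.heat t (fun z => G.rGradient R (fun v => √(f v)) z ^ 2) x := by
  obtain ⟨lam, h⟩ := G.exp_mul_rGradient_sq_sub_heat_lt hR hK hf hC x
  have h1 : Real.exp (2 * K * t) * G.rGradient R (fun z => √(G.heat t f z)) x ^ 2 ≤
      G.heat t (fun z => G.rGradient R (fun v => √(f v)) z ^ 2) x := by
    refine le_of_forall_pos_le_add fun δ hδ => ?_
    have := h (δ * Real.exp (-(lam * t))) (by positivity) t ht
    rw [mul_assoc δ, ← Real.exp_add, neg_add_cancel, Real.exp_zero, mul_one] at this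
    linarith
  have h2 := mul_le_mul_of_nonneg_left h1 (Real.exp_pos (-2 * K * t)).le
  rwa [← mul_assoc, ← Real.exp_add, show -2 * K * t + 2 * K * t = 0 by ring, Real.exp_zero,
    one_mul] at h2

/-- The gradient estimate at time `0` gives the curvature bound: a test function `g` is squared, and made
bounded away from `x`, where its values do not enter the curvature; then both sides of the estimate
agree at `t = 0` and their derivatives are compared. -/
theorem le_quadraticCurvature_of_gradient_estimate {x y : V} (hR : 0 < R)
    (hxy : G.d x y ≤ R)
    (h : ∀ f : V → ℝ, (∀ x, 0 < f x) → (∃ C : ℝ, ∀ x, f x ≤ C) → ∀ t : ℝ, 0 ≤ t →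
      G.rGradient R (fun z => √(G.heat t f z)) x ^ 2 ≤ Real.exp (-2 * K * t) *
        G.heat t (fun z => G.rGradient R (fun v => √(f v)) z ^ 2) x) :
    (K : EReal) ≤ G.quadraticCurvature R x y := by
  classical
  rw [le_quadraticCurvature_iff]
  intro g hg hgx hgy
  set f : V → ℝ := fun z => if z ∈ G.ball (R + 1) x then g z ^ 2 else 1 with hfdef
  have hf : ∀ z, 0 < f z := by
    intro z
    rw [hfdef]
    have := hg z
    dsimp only
    split_ifs <;> positivity
  obtain ⟨B, hB⟩ := ((G.ball_finite (R + 1) x).image fun z => g z ^ 2).bddAbove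
  have hC : ∀ z, f z ≤ max B 1 := by
    intro z
    by_cases hz : z ∈ G.ball (R + 1) x
    · simp only [hfdef, if_pos hz]
      exact (hB ⟨z, hz, rfl⟩).trans (le_max_left _ _)
    · simp only [hfdef, if_neg hz]
      exact le_max_right _ _
  have hadd : ∀ {k : ℕ} {a b : V}, a ∈ G.ball k x → b ∈ G.ball (R + 1 - k) a → k ≤ R + 1 →
      f b = g b ^ 2 := by
    intro k a b ha hb hk
    refine if_pos ?_
    have h1 : G.d x b ≤ (k : ℕ∞) + ((R + 1 - k : ℕ) : ℕ∞) :=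
      SimpleGraph.edist_triangle.trans (add_le_add ha hb)
    have h2 : k + (R + 1 - k) = R + 1 := by omega
    rwa [← Nat.cast_add, h2] at h1
  have hnbr : ∀ {a b : V}, b ∈ G.nbrs a → b ∈ G.ball 1 a := by
    intro a b hb
    by_cases hab : a = b
    · rw [hab]
      exact G.mem_ball_self 1 b
    · exact (SimpleGraph.edist_eq_one_iff_adj.2
        (show G.toSimpleGraph.Adj a b from ⟨hab, G.mem_nbrs.1 hb⟩)).le
  have hxx := G.mem_ball_self 0 x
  have hfy : ∀ z ∈ G.ball 1 y, f z = g z ^ 2 := fun z hz =>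
    hadd (k := R) hxy (by rwa [Nat.add_sub_cancel_left]) (by omega)
  have hfR : ∀ {a}, a ∈ G.ball 1 x → ∀ z ∈ G.ball R a, f z = g z ^ 2 := fun ha z hz =>
    hadd (k := 1) ha (by simpa using hz) (by omega)
  have hgrad : ∀ a ∈ G.ball 1 x,
      G.rGradient R (fun v => √(f v)) a ^ 2 = G.rGradient R g a ^ 2 := by
    intro a ha
    rw [G.rGradient_congr fun z hz => by rw [hfR ha z hz, Real.sqrt_sq (hg z).le]]
  have hx1 := G.mem_ball_self 1 x
  have hfx : f x = g x ^ 2 := hfR hx1 x (G.mem_ball_self R x)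
  have hfyy : f y = g y ^ 2 := hfy y (G.mem_ball_self 1 y)
  have hΔy : G.laplacian f y = G.laplacian (fun z => g z ^ 2) y :=
    G.laplacian_congr hfyy fun z hz => hfy z (hnbr hz)
  have hΔx : G.laplacian f x = G.laplacian (fun z => g z ^ 2) x :=
    G.laplacian_congr hfx fun z hz => hadd (k := 1) (hnbr hz) (G.mem_ball_self _ z) (by omega)
  set F₀ : V → ℝ := fun z => G.rGradient R (fun v => √(f v)) z ^ 2 with hF₀
  have hF₀0 : ∀ z, 0 ≤ F₀ z := fun z => sq_nonneg _
  have hf' : ∀ z, 0 ≤ f z := fun z => (hf z).le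
  have hF₀C : ∀ z, F₀ z ≤ max B 1 := fun z => G.rGradient_sqrt_sq_le hf' hC z
  have hF₀x : F₀ x = 1 := by rw [hF₀]; simp only [hgrad x hx1, hgx, one_pow]
  have hΔF : G.laplacian F₀ x = G.laplacian (fun z => G.rGradient R g z ^ 2) x :=
    G.laplacian_congr (hgrad x hx1) fun z hz => hgrad z (hnbr hz)
  have hP0 : G.heat 0 f = f := funext (G.heat_zero hf' hC)
  have hQ0 : G.heat 0 F₀ = F₀ := funext (G.heat_zero hF₀0 hF₀C)
  have hleft := G.hasDerivWithinAt_sq_sqrt_heat_sub hf hC x y le_rfl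
  have hright := (((hasDerivAt_id (0 : ℝ)).const_mul (-2 * K)).exp.hasDerivWithinAt).fun_mul
    (G.hasDerivWithinAt_heat hF₀0 hF₀C le_rfl x)
  have hcomp := hasDerivWithinAt_le_of_le_of_eq hleft hright ?_ ?_
  · rw [hP0, hQ0, hfx, hfyy, Real.sqrt_sq (hg x).le, Real.sqrt_sq (hg y).le, hΔx, hΔy, hΔF,
      hF₀x] at hcomp
    simp only [id, mul_zero, Real.exp_zero, mul_one, one_mul] at hcomp
    linarith
  · simp only [hP0, hQ0, hfx, hfyy, Real.sqrt_sq (hg x).le, Real.sqrt_sq (hg y).le, hF₀x,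
      ← sq_abs (g y - g x), hgy, id, mul_zero, Real.exp_zero, one_pow, mul_one]
  · intro t ht
    refine le_trans ?_ (h f hf ⟨_, hC⟩ t ht)
    rw [← sq_abs]
    exact pow_le_pow_left₀ (abs_nonneg _)
      (G.abs_sub_le_rGradient (fun z => √(G.heat t f z)) hxy) 2

end WeightedGraph

theorem mainTheorem4 {V : Type*} (G : WeightedGraph V) (R : ℕ) (hR : 0 < R) (K : ℝ) :
    (∀ x y : V, G.d x y ≤ (R : ℕ∞) → (K : EReal) ≤ G.quadraticCurvature R x y) ↔
      (∀ f : V → ℝ, (∀ x, 0 < f x) → (∃ C : ℝ, ∀ x, f x ≤ C) → ∀ t : ℝ, 0 ≤ t → ∀ x : V,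
        G.rGradient R (fun z => √(G.heat t f z)) x ^ 2 ≤
          Real.exp (-2 * K * t) *
            G.heat t (fun z => G.rGradient R (fun v => √(f v)) z ^ 2) x) := by
  constructor
  · rintro hK f hf ⟨C, hC⟩ t ht x
    exact G.rGradient_sqrt_heat_sq_le hR hK hf hC ht x
  · intro h x y hxy
    exact G.le_quadraticCurvature_of_gradient_estimate hR hxy
      fun f hf hC t ht => h f hf hC t ht x
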